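/- \textbf{Theorem (Sublinear time algorithm on fully-connected networks).} \emph{Model.} An $n$-node weighted network $(G,w)$ is an undirected graph $G$ whose $n$ nodes have distinct identifiers in $\{1,\dots,p(n)\}$, together with edge weights $w:E(G)\to\{1,\dots,q(n)\}$, where $p,q$ are fixed polynomials. It is fully connected if $G$ is the complete graph. Computation is synchronous. At the start each node knows only $n$, its own identifier, the identifiers of its neighbours and the weights of its incident edges, together with any private input. In every round each node sends a message of $\lceil\log_2 n\rceil$ bits along each of its incident edges, possibly different messages along different edges, and the messages arrive at the end of the round. Local computation is free and unrestricted. The running time is the number of rounds, and $\tilde O(f(n))$ means $O(f(n)\log^k n)$ for some constant $k$. Write $\mathrm{dist}_{G,w}(u,v)$ for the least total weight of a $u$-$v$ path. \emph{Claim.} Fix the polynomials $p$ and $q$. (i) (SSSP, exact.) There is a deterministic algorithm which, on every fully-connected $n$-node weighted network $(G,w)$ and for every source node $s$ whose identifier is known to all nodes, takes $\tilde O(n^{1/2})$ rounds and at the end of which every node $v$ outputs exactly $\mathrm{dist}_{G,w}(s,v)$. (ii) (APSP, $(2+o(1))$-approximate.) For every constant $c$ there are a function $\varepsilon(n)\to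 0$ and a randomized algorithm, in which every node has a private string of independent fair random bits, whose length is finite and depends only on $n$, such that the following holds. On every fully-connected $n$-node weighted network $(G,w)$ the algorithm takes $\tilde O(n^{1/2})$ rounds, and with probability at least $1-1/n^{c}$ the outputs satisfy: for all nodes $u,v$, both $u$ and $v$ know a common value $\widetilde{\mathrm{dist}}(u,v)$ with \[ \mathrm{dist}_{G,w}(u,v)\ \le\ \widetilde{\mathrm{dist}}(u,v)\ \le\ (2+\varepsilon(n))\,\mathrm{dist}_{G,w}(u,v). \] The constants hidden in the round bounds depend only on $p$, $q$ and, in (ii), on $c$. -/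

import Mathlib

open Filter Topology Asymptotics

/-- A weighted network on `n` nodes. The nodes are named by their unique identifiers, which lie in
`{1, …, p(n)}`; every edge has an integer weight in `{1, …, q(n)}`. The values of `weight` at pairs
that are not edges carry no meaning and are never used. -/
structure WeightedNetwork (p q : Polynomial ℕ) (n : ℕ) where
  nodes : Finset ℕ
  card_nodes : nodes.card = n
  one_le_id : ∀ v ∈ nodes, 1 ≤ v
  id_le : ∀ v ∈ nodes, v ≤ p.eval n
  graph : SimpleGraph nodes
  weight : Sym2 nodes → ℕ
  one_le_weight : ∀ e ∈ graph.edgeSet, 1 ≤ weight e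
  weight_le : ∀ e ∈ graph.edgeSet, weight e ≤ q.eval n

/-- What a node knows about the network at the start: its own identifier, the identifiers of its
neighbours, and the weights of its incident edges (`weight j` is the weight of the edge to the
neighbour `j`, and `0` if `j` is not a neighbour). -/
structure LocalInput where
  id : ℕ
  neighbors : Finset ℕ
  weight : ℕ → ℕ

/-- The content of one message on an `n`-node network: a string of `⌈log₂ n⌉` bits. -/
abbrev Message (n : ℕ) : Type := Fin (Nat.clog 2 n) → Bool

/-- A synchronous message-passing algorithm for `n`-node networks (all nodes know `n`), in which
every node gets a further private input in `I` and finally has an output in `O`. Local computation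
is unrestricted. The same code runs at all nodes; `send σ j` is the message that a node in state `σ`
sends to its neighbour with identifier `j`, and `receive σ m` is the new state of a node in state
`σ` for which `m j` is the message that came from its neighbour with identifier `j`
(`none` if it has no such neighbour). -/
structure DistAlgorithm (n : ℕ) (I O : Type) where
  State : Type
  init : LocalInput → I → State
  send : State → ℕ → Message n
  receive : State → (ℕ → Option (Message n)) → State
  output : State → O

namespace WeightedNetwork

variable {p q : Polynomial ℕ} {n : ℕ} (N : WeightedNetwork p q n)

open Classical in
/-- The initial knowledge of node `v`. -/
noncomputable def localInput (v : N.nodes) : LocalInput where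
  id := v
  neighbors := (Finset.univ.filter fun u : N.nodes => N.graph.Adj v u).image Subtype.val
  weight j := if h : j ∈ N.nodes then
      if N.graph.Adj v ⟨j, h⟩ then N.weight s(v, ⟨j, h⟩) else 0
    else 0

/-- The weight of a path: the sum of the weights of its edges. -/
def pathWeight {u v : N.nodes} (P : N.graph.Walk u v) : ℕ :=
  (P.edges.map N.weight).sum

/-- The distance between two nodes of a connected network: the least weight of a path. -/
noncomputable def dist (u v : N.nodes) : ℕ :=
  sInf (Set.range fun P : N.graph.Walk u v => N.pathWeight P)

end WeightedNetwork

namespace DistAlgorithm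

variable {p q : Polynomial ℕ} {n : ℕ} {I O : Type}

open Classical in
/-- The messages that node `v` receives in a round that the nodes begin in the states `σ`. -/
noncomputable def inbox (A : DistAlgorithm n I O) (N : WeightedNetwork p q n)
    (σ : N.nodes → A.State) (v : N.nodes) (j : ℕ) : Option (Message n) :=
  if h : j ∈ N.nodes then
    if N.graph.Adj ⟨j, h⟩ v then some (A.send (σ ⟨j, h⟩) v) else none
  else none

/-- The states of the nodes after `t` rounds, when node `v` has the private input `x v`. -/
noncomputable def run (A : DistAlgorithm n I O) (N : WeightedNetwork p q n) (x : N.nodes → I) :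
    ℕ → N.nodes → A.State
  | 0 => fun v => A.init (N.localInput v) (x v)
  | t + 1 => fun v => A.receive (run A N x t v) (A.inbox N (run A N x t) v)

/-- The output of node `v` after `T` rounds. -/
noncomputable def outputAfter (A : DistAlgorithm n I O) (N : WeightedNetwork p q n)
    (x : N.nodes → I) (T : ℕ) (v : N.nodes) : O :=
  A.output (A.run N x T v)

/-- In `T` rounds `A` solves the single-source shortest paths problem exactly on `N`, whatever the
source `s`: with the identifier of `s` as the input of all nodes, every node `v` outputs its
distance from `s`. -/
def SolvesSSSP (A : DistAlgorithm n ℕ ℕ) (N : WeightedNetwork p q n) (T : ℕ) : Prop :=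
  ∀ s v : N.nodes, A.outputAfter N (fun _ => (s : ℕ)) T v = N.dist s v

/-- After `T` rounds of `A` on the private inputs `x`, any two nodes `u` and `v` know one common
value, which is an `α`-approximation of their distance: the output of `u` is a table of the
estimates of its distances to the nodes, by identifier. -/
def ApproximatesAPSP (A : DistAlgorithm n I (ℕ → ℝ)) (N : WeightedNetwork p q n)
    (x : N.nodes → I) (T : ℕ) (α : ℝ) : Prop :=
  ∀ u v : N.nodes,
    A.outputAfter N x T u v = A.outputAfter N x T v u ∧
    (N.dist u v : ℝ) ≤ A.outputAfter N x T u v ∧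
    A.outputAfter N x T u v ≤ α * N.dist u v

end DistAlgorithm

/-- The probability of an event under the uniform distribution on a finite sample space. -/
noncomputable def uniformProb {Ω : Type} [Fintype Ω] (E : Set Ω) : ℝ :=
  (E.ncard : ℝ) / Fintype.card Ω

/-- `T(n) = Õ(f(n))`: the bound `O(f(n))` up to a factor polylogarithmic in `n`. -/
def IsSoftO (T : ℕ → ℕ) (f : ℕ → ℝ) : Prop :=
  ∃ k : ℕ, (fun n => (T n : ℝ)) =O[atTop] fun n => f n * Real.log n ^ k

/-! In a complete network every pair of nodes is joined by an edge of weight at most `q(n)`, so all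
distances are at most `q(n)`. As edge weights are at least 1, a lightest path then has at most
`q(n)` edges. Hence `O(log n)` min-plus squarings of the weight matrix give all distances exactly
(`powDist_eq_dist`), and every intermediate entry fits in `O(log n)` bits.

One squaring is spread over the nodes. The nodes are cut into about `√n` groups of about `√n`, and
each ordered pair of groups is assigned its own node, which collects the two corresponding blocks of
columns and returns the block of the product (`squaringAlgorithm_two_rounds`). Each edge carries
`O(√n)` matrix entries, hence `O(√n log n)` bits, which are sent at one bit per round
(`exists_memory`). The total is `O(√n log² n)` rounds.

Both claims are read off from the rows of the exact distance matrix. -/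

/-- A synchronous algorithm for the complete graph with a loop at every node, in which a message is
a table of natural numbers: `send M j r` is entry `r` of the message that a node with memory `M`
sends to the node `j`, and in `receive M f` the entry `r` of the message from `j` is `f j r`. -/
structure TableAlgorithm (I O : Type) where
  Memory : Type
  init : LocalInput → I → Memory
  send : Memory → ℕ → ℕ → ℕ
  receive : Memory → (ℕ → ℕ → ℕ) → Memory
  output : Memory → O

/-! ### Simulating table messages by streams of single bits. -/

namespace TableAlgorithm

variable {I O : Type}

/-- The state of a node that transmits a table bit by bit: its identifier, its memory, the number of
bits sent along each edge, and the bits received (`buffer j k` is bit `k` from node `j`). -/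
structure StreamState (A : TableAlgorithm I O) where
  id : ℕ
  memory : A.Memory
  time : ℕ
  buffer : ℕ → ℕ → Bool

/-- Bit `k` of the message to `j`, when every entry of the table takes `L` bits. -/
def bit (A : TableAlgorithm I O) (L : ℕ) (M : A.Memory) (j k : ℕ) : Bool :=
  (A.send M j (k / L)).testBit (k % L)

/-- The first bit of a message, if there is one. -/
def firstBit {n : ℕ} : Option (Message n) → Bool
  | none => false
  | some m => if h : 0 < Nat.clog 2 n then m ⟨0, h⟩ else false

/-- The table of numbers with `L` bits that are written one after another in a buffer. -/
def decode (L : ℕ) (b : ℕ → ℕ → Bool) (j r : ℕ) : ℕ :=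
  Nat.ofBits fun i : Fin L => b j (r * L + i)

/-- The buffer of a node after it has received the messages `m`. -/
def updatedBuffer (A : TableAlgorithm I O) {n : ℕ} (L : ℕ) (σ : A.StreamState)
    (m : ℕ → Option (Message n)) (j k : ℕ) : Bool :=
  if k = σ.time then
    if j = σ.id then A.bit L σ.memory j k else firstBit (m j)
  else σ.buffer j k

/-- The implementation of a table algorithm by messages that carry one bit each; a table has `R`
entries of `L` bits, so that one round of the table algorithm takes `R * L` rounds. -/
def stream (A : TableAlgorithm I O) (n R L : ℕ) : DistAlgorithm n I O where
  State := A.StreamState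
  init x i := ⟨x.id, A.init x i, 0, fun _ _ => false⟩
  send σ j := fun _ => A.bit L σ.memory j σ.time
  receive σ m :=
    if σ.time + 1 = R * L then
      ⟨σ.id, A.receive σ.memory (decode L (A.updatedBuffer L σ m)), 0, σ.buffer⟩
    else ⟨σ.id, σ.memory, σ.time + 1, A.updatedBuffer L σ m⟩
  output σ := A.output σ.memory

variable {p q : Polynomial ℕ} {n : ℕ} (A : TableAlgorithm I O) (R L : ℕ)
  (N : WeightedNetwork p q n) (x : N.nodes → I)

theorem firstBit_inbox (hN : N.graph = ⊤) (σ : N.nodes → A.StreamState) {v j : N.nodes}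
    (hjv : j ≠ v) :
    firstBit ((A.stream n R L).inbox N σ v j) = A.bit L (σ j).memory v (σ j).time := by
  -- Messages could be empty for `n ≤ 1`; two distinct nodes force `n ≥ 2`.
  have hn : 0 < Nat.clog 2 n := by
    apply Nat.clog_pos (by norm_num)
    have h2 : ({j, v} : Finset N.nodes).card ≤ Fintype.card N.nodes := Finset.card_le_univ _
    rw [Finset.card_pair hjv, Fintype.card_coe, N.card_nodes] at h2
    exact h2
  simp [DistAlgorithm.inbox, hN, hjv, firstBit, stream, hn]

/-- This realizes the loops of the table model: a node reads the bit addressed to itself from its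
own memory, and all other bits travel along edges. -/
theorem updatedBuffer_inbox (hN : N.graph = ⊤) (σ : N.nodes → A.StreamState) {t : ℕ}
    (ht : ∀ v, (σ v).time = t) (hid : ∀ v, (σ v).id = v) (v j : N.nodes) :
    A.updatedBuffer L (σ v) ((A.stream n R L).inbox N σ v) j t = A.bit L (σ j).memory v t := by
  by_cases hjv : j = v
  · subst hjv
    simp [updatedBuffer, ht, hid]
  · have : (j : ℕ) ≠ v := fun h => hjv (Subtype.ext h)
    simp [updatedBuffer, ht, hid, this, A.firstBit_inbox R L N hN σ hjv]

/-- During the transmission of a table the nodes keep their memories and collect the bits. -/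
theorem run_within_block (hN : N.graph = ⊤) {T : ℕ}
    (hT : ∀ v, ((A.stream n R L).run N x T v).time = 0 ∧ ((A.stream n R L).run N x T v).id = v) :
    ∀ t < R * L, ∀ v,
      ((A.stream n R L).run N x (T + t) v).time = t ∧
      ((A.stream n R L).run N x (T + t) v).id = v ∧
      ((A.stream n R L).run N x (T + t) v).memory = ((A.stream n R L).run N x T v).memory ∧
      ∀ j : N.nodes, ∀ k < t, ((A.stream n R L).run N x (T + t) v).buffer j k =
        A.bit L ((A.stream n R L).run N x T j).memory v k := by
  intro t
  induction t with
  | zero => intro _ v; exact ⟨(hT v).1, (hT v).2, rfl, by simp⟩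
  | succ t ih =>
    intro ht v
    have ih := ih (by omega)
    have hrun : (A.stream n R L).run N x (T + (t + 1)) v =
        ⟨((A.stream n R L).run N x (T + t) v).id, ((A.stream n R L).run N x (T + t) v).memory,
          ((A.stream n R L).run N x (T + t) v).time + 1,
          A.updatedBuffer L ((A.stream n R L).run N x (T + t) v)
            ((A.stream n R L).inbox N ((A.stream n R L).run N x (T + t)) v)⟩ := by
      have h : ((A.stream n R L).run N x (T + t) v).time + 1 ≠ R * L := by
        rw [(ih v).1]; omega
      exact if_neg h
    rw [hrun]
    refine ⟨by simp [(ih v).1], by simp [(ih v).2.1], (ih v).2.2.1, fun j k hk => ?_⟩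
    rcases Nat.lt_succ_iff_lt_or_eq.1 hk with hk | rfl
    · rw [← (ih v).2.2.2 j k hk]
      simp only [updatedBuffer, (ih v).1]
      rw [if_neg hk.ne]
    · rw [← (ih j).2.2.1]
      exact A.updatedBuffer_inbox R L N hN _ (fun v => (ih v).1) (fun v => (ih v).2.1) v j

/-- A full transmission delivers the entries of the tables, up to multiples of `2 ^ L`. -/
theorem run_block (hN : N.graph = ⊤) (hRL : 0 < R * L) {T : ℕ}
    (hT : ∀ v, ((A.stream n R L).run N x T v).time = 0 ∧ ((A.stream n R L).run N x T v).id = v)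
    (v : N.nodes) :
    ((A.stream n R L).run N x (T + R * L) v).time = 0 ∧
    ((A.stream n R L).run N x (T + R * L) v).id = v ∧
    ∃ f : ℕ → ℕ → ℕ,
      ((A.stream n R L).run N x (T + R * L) v).memory =
        A.receive ((A.stream n R L).run N x T v).memory f ∧
      ∀ j : N.nodes, ∀ r < R,
        f j r = A.send ((A.stream n R L).run N x T j).memory v r % 2 ^ L := by
  obtain ⟨t, ht⟩ : ∃ t, R * L = t + 1 := ⟨R * L - 1, by omega⟩
  have ih := A.run_within_block R L N x hN hT t (by omega)
  have hrun : (A.stream n R L).run N x (T + R * L) v =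
      ⟨((A.stream n R L).run N x (T + t) v).id,
        A.receive ((A.stream n R L).run N x (T + t) v).memory
          (decode L (A.updatedBuffer L ((A.stream n R L).run N x (T + t) v)
            ((A.stream n R L).inbox N ((A.stream n R L).run N x (T + t)) v))), 0,
        ((A.stream n R L).run N x (T + t) v).buffer⟩ := by
    have h : (A.stream n R L).run N x (T + R * L) v = (A.stream n R L).run N x (T + t + 1) v := by
      rw [ht, add_assoc]
    have h' : ((A.stream n R L).run N x (T + t) v).time + 1 = R * L := by
      rw [(ih v).1, ht]
    exact h.trans (if_pos h')
  rw [hrun]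
  refine ⟨rfl, (ih v).2.1, _, by rw [(ih v).2.2.1], fun j r hr => ?_⟩
  rw [decode, ← Nat.ofBits_testBit]
  congr 1
  funext i
  have hL : 0 < L := i.pos
  have hk : r * L + i < t + 1 := by
    have := Nat.mul_le_mul_right L (Nat.succ_le_of_lt hr)
    rw [Nat.succ_mul] at this
    have := i.2
    omega
  have hbit : A.bit L ((A.stream n R L).run N x T j).memory v (r * L + i) =
      (A.send ((A.stream n R L).run N x T j).memory v r).testBit i := by
    rw [bit, mul_comm r L, Nat.mul_add_div hL, Nat.div_eq_of_lt i.2, Nat.mul_add_mod,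
      Nat.mod_eq_of_lt i.2, add_zero]
  rw [← hbit]
  -- Earlier bits are already in the buffer; bit `t` arrives in the closing round itself and is
  -- decoded without being stored.
  rcases Nat.lt_succ_iff_lt_or_eq.1 hk with hk | hk
  · rw [← (ih v).2.2.2 j _ hk]
    simp only [updatedBuffer, (ih v).1]
    rw [if_neg hk.ne]
  · rw [hk, ← (ih j).2.2.1]
    exact A.updatedBuffer_inbox R L N hN _ (fun v => (ih v).1) (fun v => (ih v).2.1) v j

/-- The memories `M s v` of the nodes `v` after `s` rounds of a table algorithm that is implemented
by streaming. -/
theorem exists_memory (hN : N.graph = ⊤) (hRL : 0 < R * L) :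
    ∃ M : ℕ → N.nodes → A.Memory,
      (∀ v, M 0 v = A.init (N.localInput v) (x v)) ∧
      (∀ s v, ∃ f : ℕ → ℕ → ℕ, M (s + 1) v = A.receive (M s v) f ∧
        ∀ j : N.nodes, ∀ r < R, f j r = A.send (M s j) v r % 2 ^ L) ∧
      ∀ s v, (A.stream n R L).outputAfter N x (s * (R * L)) v = A.output (M s v) := by
  have hinv : ∀ s v, ((A.stream n R L).run N x (s * (R * L)) v).time = 0 ∧
      ((A.stream n R L).run N x (s * (R * L)) v).id = v := by
    intro s
    induction s with
    | zero => intro v; rw [Nat.zero_mul]; exact ⟨rfl, rfl⟩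
    | succ s ih =>
      intro v
      rw [Nat.succ_mul]
      exact ⟨(A.run_block R L N x hN hRL ih v).1, (A.run_block R L N x hN hRL ih v).2.1⟩
  refine ⟨fun s v => ((A.stream n R L).run N x (s * (R * L)) v).memory, fun v => ?_,
    fun s v => ?_, fun s v => rfl⟩
  · simp only [Nat.zero_mul]; rfl
  · simp only [Nat.succ_mul]
    exact (A.run_block R L N x hN hRL (hinv s) v).2.2

end TableAlgorithm

/-! ### Min-plus powers of the weight matrix and distances. -/

namespace WeightedNetwork

variable {p q : Polynomial ℕ} {n : ℕ} (N : WeightedNetwork p q n)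

/-- The iterated min-plus squares of the weight matrix of a complete network. -/
noncomputable def powDist : ℕ → N.nodes → N.nodes → ℕ
  | 0 => fun u v => (N.localInput u).weight v
  | k + 1 => fun u v => ⨅ w, powDist k u w + powDist k w v

/-- The default weight 0 at non-neighbours supplies the zero diagonal. Thanks to it the `k`-th
square accounts for all walks of at most `2 ^ k` edges, not only those of exactly that length. -/
theorem powDist_zero_self (u : N.nodes) : N.powDist 0 u u = 0 := by
  simp [powDist, localInput]

theorem powDist_zero_of_ne (hN : N.graph = ⊤) {u v : N.nodes} (h : u ≠ v) :
    N.powDist 0 u v = N.weight s(u, v) := by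
  simp [powDist, localInput, hN, h]

theorem powDist_succ_le (k : ℕ) (u w v : N.nodes) :
    N.powDist (k + 1) u v ≤ N.powDist k u w + N.powDist k w v :=
  Nat.sInf_le ⟨w, rfl⟩

theorem exists_powDist_succ_eq (k : ℕ) (u v : N.nodes) :
    ∃ w, N.powDist (k + 1) u v = N.powDist k u w + N.powDist k w v := by
  have : Nonempty N.nodes := ⟨u⟩
  obtain ⟨w, hw⟩ := Nat.sInf_mem (Set.range_nonempty fun w => N.powDist k u w + N.powDist k w v)
  exact ⟨w, hw.symm⟩

theorem powDist_self (k : ℕ) (u : N.nodes) : N.powDist k u u = 0 := by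
  induction k with
  | zero => exact N.powDist_zero_self u
  | succ k ih => simpa [ih] using N.powDist_succ_le k u u u

theorem powDist_comm (hN : N.graph = ⊤) (k : ℕ) (u v : N.nodes) :
    N.powDist k u v = N.powDist k v u := by
  induction k generalizing u v with
  | zero =>
    by_cases h : u = v
    · rw [h]
    · rw [N.powDist_zero_of_ne hN h, N.powDist_zero_of_ne hN (Ne.symm h), Sym2.eq_swap]
  | succ k ih =>
    simp only [powDist]
    exact iInf_congr fun w => by rw [ih u w, ih w v, add_comm]

theorem powDist_succ_le_self (k : ℕ) (u v : N.nodes) :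
    N.powDist (k + 1) u v ≤ N.powDist k u v := by
  simpa [N.powDist_self] using N.powDist_succ_le k u u v

theorem powDist_le (hN : N.graph = ⊤) (k : ℕ) (u v : N.nodes) :
    N.powDist k u v ≤ q.eval n := by
  induction k with
  | zero =>
    by_cases h : u = v
    · rw [h, N.powDist_self]; exact Nat.zero_le _
    · rw [N.powDist_zero_of_ne hN h]
      exact N.weight_le _ (by simp [hN, h])
  | succ k ih => exact (N.powDist_succ_le_self k u v).trans ih

theorem pathWeight_append {u v w : N.nodes} (P : N.graph.Walk u v) (Q : N.graph.Walk v w) :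
    N.pathWeight (P.append Q) = N.pathWeight P + N.pathWeight Q := by
  simp [pathWeight]

theorem exists_pathWeight_eq_powDist (hN : N.graph = ⊤) (k : ℕ) (u v : N.nodes) :
    ∃ P : N.graph.Walk u v, N.pathWeight P = N.powDist k u v := by
  induction k generalizing u v with
  | zero =>
    by_cases h : u = v
    · subst h
      exact ⟨.nil, by simp [pathWeight, N.powDist_self]⟩
    · have hadj : N.graph.Adj u v := by simp [hN, h]
      exact ⟨hadj.toWalk, by simp [pathWeight, N.powDist_zero_of_ne hN h]⟩
  | succ k ih =>
    obtain ⟨w, hw⟩ := N.exists_powDist_succ_eq k u v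
    obtain ⟨P, hP⟩ := ih u w
    obtain ⟨Q, hQ⟩ := ih w v
    exact ⟨P.append Q, by rw [pathWeight_append, hP, hQ, hw]⟩

/-- Cut the walk after `2 ^ k` edges: both pieces have at most `2 ^ k` edges, and the cut vertex is
a candidate in the minimum. -/
theorem powDist_le_pathWeight (hN : N.graph = ⊤) (k : ℕ) {u v : N.nodes} (P : N.graph.Walk u v)
    (hP : P.length ≤ 2 ^ k) : N.powDist k u v ≤ N.pathWeight P := by
  induction k generalizing u v with
  | zero =>
    cases P with
    | nil => simp [N.powDist_self]
    | cons h P =>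
      cases P with
      | nil => rw [N.powDist_zero_of_ne hN h.ne]; simp [pathWeight]
      | cons h' P => simp at hP
  | succ k ih =>
    calc N.powDist (k + 1) u v
        ≤ N.powDist k u (P.getVert (2 ^ k)) + N.powDist k (P.getVert (2 ^ k)) v :=
          N.powDist_succ_le k _ _ _
      _ ≤ N.pathWeight (P.take (2 ^ k)) + N.pathWeight (P.drop (2 ^ k)) := by
          refine Nat.add_le_add (ih _ ?_) (ih _ ?_)
          · simp 
          · rw [pow_succ] at hP
            rw [SimpleGraph.Walk.drop_length]
            omega
      _ = N.pathWeight P := by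
          rw [pathWeight, pathWeight, SimpleGraph.Walk.edges_take, SimpleGraph.Walk.edges_drop,
            ← List.sum_append, ← List.map_append, List.take_append_drop, pathWeight]

theorem length_le_pathWeight {u v : N.nodes} (P : N.graph.Walk u v) :
    P.length ≤ N.pathWeight P := by
  induction P with
  | nil => simp
  | cons h P ih =>
    have := N.one_le_weight _ ((SimpleGraph.mem_edgeSet _).2 h)
    simp only [pathWeight, SimpleGraph.Walk.edges_cons, List.map_cons, List.sum_cons,
      SimpleGraph.Walk.length_cons] at ih ⊢
    omega

/-- Logarithmically many min-plus squarings of the weight matrix yield the distances. -/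
theorem powDist_eq_dist (hN : N.graph = ⊤) {k : ℕ} (hk : q.eval n ≤ 2 ^ k) (u v : N.nodes) :
    N.powDist k u v = N.dist u v := by
  obtain ⟨P, hP⟩ := N.exists_pathWeight_eq_powDist hN k u v
  have hle : N.dist u v ≤ N.powDist k u v := Nat.sInf_le ⟨P, hP⟩
  obtain ⟨Q, hQ⟩ := Nat.sInf_mem (⟨_, P, rfl⟩ : (Set.range N.pathWeight).Nonempty)
  have hQ : N.pathWeight Q = N.dist u v := hQ
  refine le_antisymm ?_ hle
  rw [← hQ]
  refine N.powDist_le_pathWeight hN k Q ?_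
  -- The chain is length ≤ weight = distance ≤ `powDist` ≤ `q(n)` ≤ `2 ^ k`.
  have := N.length_le_pathWeight Q
  have := N.powDist_le hN k u v
  omega

end WeightedNetwork

/-! ### Logarithms of polynomial bounds. -/

theorem Polynomial.exists_log_eval_le (q : Polynomial ℕ) :
    ∃ C : ℕ, ∀ n, 2 ≤ n → Nat.clog 2 (q.eval n + 1) ≤ C * Nat.clog 2 n := by
  obtain ⟨C, hC⟩ : ∃ C : ℕ, ∀ n, 2 ≤ n → q.eval n + 1 ≤ n ^ C := by
    induction q using Polynomial.induction_on with
    | C a =>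
      refine ⟨a + 1, fun n hn => ?_⟩
      rw [Polynomial.eval_C]
      exact (Nat.lt_pow_self hn).le
    | add f g hf hg =>
      obtain ⟨a, ha⟩ := hf
      obtain ⟨b, hb⟩ := hg
      -- The extra factor `n ≥ 2` absorbs the sum of two terms.
      refine ⟨a + b + 1, fun n hn => ?_⟩
      have h1 := (ha n hn).trans (Nat.pow_le_pow_right (by omega) (Nat.le_add_right a b))
      have h2 := (hb n hn).trans (Nat.pow_le_pow_right (by omega) (Nat.le_add_left b a))
      rw [Polynomial.eval_add, pow_succ]
      nlinarith
    | monomial m a h =>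
      obtain ⟨b, hb⟩ := h
      refine ⟨b + 1, fun n hn => ?_⟩
      have := hb n hn
      simp only [Polynomial.eval_mul, Polynomial.eval_C, Polynomial.eval_pow,
        Polynomial.eval_X] at this ⊢
      rw [pow_succ n b, pow_succ n m, ← mul_assoc]
      nlinarith
  refine ⟨C, fun n hn => Nat.clog_le_of_le_pow ((hC n hn).trans ?_)⟩
  rw [mul_comm, pow_mul]
  exact Nat.pow_le_pow_left (Nat.le_pow_clog (by norm_num) n) C

/-! ### Numbering the nodes by the ranks of their identifiers. -/

namespace Finset

/-- The number of elements of `V` below `j`. -/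
def rank (V : Finset ℕ) (j : ℕ) : ℕ := Nat.count (· ∈ V) j

/-- The element of `V` of rank `a`. -/
noncomputable def ofRank (V : Finset ℕ) (a : ℕ) : ℕ := Nat.nth (· ∈ V) a

variable {V : Finset ℕ}

theorem card_toFinset_ofPred_mem (hf : (Set.ofPred (· ∈ V)).Finite) :
    hf.toFinset.card = V.card := by
  congr 1
  ext j
  simp

theorem rank_lt_card {j : ℕ} (hj : j ∈ V) : V.rank j < V.card := by
  have hf : (Set.ofPred (· ∈ V)).Finite := V.finite_toSet
  rw [← card_toFinset_ofPred_mem hf]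
  exact Nat.count_lt_card hf hj

theorem ofRank_rank {j : ℕ} (hj : j ∈ V) : V.ofRank (V.rank j) = j :=
  Nat.nth_count hj

theorem ofRank_mem {a : ℕ} (ha : a < V.card) : V.ofRank a ∈ V :=
  Nat.nth_mem a fun hf => by rwa [card_toFinset_ofPred_mem hf]

theorem rank_ofRank {a : ℕ} (ha : a < V.card) : V.rank (V.ofRank a) = a :=
  Nat.count_nth fun hf => by rwa [card_toFinset_ofPred_mem hf]

end Finset

/-! ### Distributed min-plus squaring. -/

/-- The memory of a node that squares matrices in the min-plus semiring: its private input, its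
identifier, all identifiers, its row of the current matrix, and the table received last. -/
structure SquaringMemory (I : Type) where
  input : I
  id : ℕ
  nodes : Finset ℕ
  row : ℕ → ℕ
  table : ℕ → ℕ → ℕ

/-- The number of groups of nodes; every pair of groups is served by a node of its own. -/
def numGroups (V : Finset ℕ) : ℕ := Nat.sqrt V.card

/-- The number of nodes in a group. -/
def groupSize (V : Finset ℕ) : ℕ := Nat.sqrt V.card + 2

theorem numGroups_mul_self_le (V : Finset ℕ) : numGroups V * numGroups V ≤ V.card :=
  Nat.sqrt_le _

/-- With `s = ⌊√n⌋`, `n < (s + 1)² = s (s + 2) + 1`, so `s` groups of size `s + 2` hold all nodes.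
The surplus 2 in the group size keeps the number of pairs of groups at `s² ≤ n`. -/
theorem div_groupSize_lt {V : Finset ℕ} {a : ℕ} (ha : a < V.card) :
    a / groupSize V < numGroups V := by
  rw [Nat.div_lt_iff_lt_mul (by simp [groupSize])]
  have := Nat.lt_succ_sqrt V.card
  simp only [numGroups, groupSize, Nat.succ_eq_add_one] at *
  have : (Nat.sqrt V.card + 1) * (Nat.sqrt V.card + 1) =
      Nat.sqrt V.card * (Nat.sqrt V.card + 2) + 1 := by ring
  omega

/-- An entry of a min-plus product, by the columns of the two factors that a table holds at `a` and
at `b`. -/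
noncomputable def minPlusEntry (V : Finset ℕ) (f : ℕ → ℕ → ℕ) (a b : ℕ) : ℕ :=
  ⨅ w : V, f w a + f w b

/-- Min-plus squaring of a symmetric matrix whose rows are held by the nodes. With `h` groups of `g`
nodes, the node of rank `i * h + j` computes the block of the square for the groups `i` and `j`:
for this purpose every node `w` sends it the columns `w` of the blocks of the groups `i` and `j`
(entries below `2 * g` of the message), and it returns to every node of group `i` the corresponding
row of the block (the remaining `g` entries). Two rounds make one squaring. -/
noncomputable def squaringAlgorithm (I O : Type) (out : I → (ℕ → ℕ) → O) :
    TableAlgorithm I O where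
  Memory := SquaringMemory I
  init x i := ⟨i, x.id, insert x.id x.neighbors, x.weight, fun _ _ => 0⟩
  send M j r :=
    let V := M.nodes
    let g := groupSize V
    let h := numGroups V
    if r < g then M.row (V.ofRank (V.rank j / h * g + r))
    else if r < 2 * g then M.row (V.ofRank (V.rank j % h * g + (r - g)))
    else minPlusEntry V M.table (V.rank j % g) (g + (r - 2 * g))
  receive M f :=
    let V := M.nodes
    let g := groupSize V
    let h := numGroups V
    { M with
      row := fun v => f (V.ofRank (V.rank M.id / g * h + V.rank v / g)) (2 * g + V.rank v % g)
      table := f }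
  output M := out M.input M.row

/-- Two rounds of the squaring algorithm square the matrix. -/
theorem squaringAlgorithm_two_rounds {I O : Type} (out : I → (ℕ → ℕ) → O)
    {V : Finset ℕ} {L : ℕ} {M : ℕ → V → SquaringMemory I}
    (hid : ∀ s v, (M s v).id = v) (hnodes : ∀ s v, (M s v).nodes = V)
    (hstep : ∀ s v, ∃ f : ℕ → ℕ → ℕ,
      M (s + 1) v = (squaringAlgorithm I O out).receive (M s v) f ∧
      ∀ j : V, ∀ r < 3 * groupSize V,
        f j r = (squaringAlgorithm I O out).send (M s j) v r % 2 ^ L)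
    {s : ℕ} {D : V → V → ℕ} (hD : ∀ u (v : V), (M s u).row v = D u v)
    (hsymm : ∀ u v, D u v = D v u) (hself : ∀ u, D u u = 0) (hlt : ∀ u v, D u v < 2 ^ L)
    (u v : V) : (M (s + 2) u).row v = ⨅ w, D u w + D w v := by
  set g := groupSize V with hg
  set h := numGroups V with hh
  have hgpos : 0 < g := by simp [hg, groupSize]
  have hu : V.rank u / g < h := div_groupSize_lt (V.rank_lt_card u.2)
  have hv : V.rank v / g < h := div_groupSize_lt (V.rank_lt_card v.2)
  have hhpos : 0 < h := (Nat.zero_le _).trans_lt hu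
  set X := V.rank u / g * h + V.rank v / g with hX
  have hXlt : X < V.card := by
    suffices X < h * h from this.trans_le (numGroups_mul_self_le V)
    have := Nat.mul_le_mul_right h (Nat.succ_le_of_lt hu)
    rw [Nat.succ_mul] at this
    omega
  have hXdiv : X / h = V.rank u / g := by
    rw [hX, mul_comm, Nat.mul_add_div hhpos, Nat.div_eq_of_lt hv, add_zero]
  have hXmod : X % h = V.rank v / g := by
    rw [hX, mul_comm, Nat.mul_add_mod, Nat.mod_eq_of_lt hv]
  let x : V := ⟨V.ofRank X, V.ofRank_mem hXlt⟩
  have hxrank : V.rank x = X := V.rank_ofRank hXlt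
  have humod := Nat.mod_lt (V.rank u) hgpos
  have hvmod := Nat.mod_lt (V.rank v) hgpos
  -- After the first round only the tables matter. The rows are then meaningless, having come from
  -- stale tables, and the second round overwrites them.
  have htable : ∀ w : V, (M (s + 1) x).table w (V.rank u % g) = D w u ∧
      (M (s + 1) x).table w (g + V.rank v % g) = D w v := by
    obtain ⟨f, hf, hfval⟩ := hstep s x
    intro w
    rw [hf]
    constructor
    · change f w _ = _
      rw [hfval w _ (by omega)]
      simp only [squaringAlgorithm, hnodes, ← hg, ← hh, if_pos humod]
      rw [hxrank, hXdiv, mul_comm, Nat.div_add_mod, V.ofRank_rank u.2, hD,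
        Nat.mod_eq_of_lt (hlt _ _)]
    · change f w _ = _
      rw [hfval w _ (by omega)]
      have h1 : ¬ g + V.rank v % g < g := by omega
      have h2 : g + V.rank v % g < 2 * g := by omega
      simp only [squaringAlgorithm, hnodes, ← hg, ← hh, if_neg h1, if_pos h2]
      rw [hxrank, hXmod, Nat.add_sub_cancel_left, mul_comm, Nat.div_add_mod, V.ofRank_rank v.2, hD,
        Nat.mod_eq_of_lt (hlt _ _)]
  obtain ⟨f, hf, hfval⟩ := hstep (s + 1) u
  -- Taking `w = u` shows that the new entry survives reduction modulo `2 ^ L`.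
  have hle : (⨅ w, D u w + D w v) < 2 ^ L := by
    refine lt_of_le_of_lt (Nat.sInf_le ⟨u, rfl⟩) ?_
    simpa only [hself, zero_add] using hlt u v
  rw [hf]
  simp only [squaringAlgorithm, hnodes, hid, ← hg, ← hh, ← hX]
  rw [show V.ofRank X = x from rfl, hfval x _ (by omega)]
  have h1 : ¬ 2 * g + V.rank v % g < g := by omega
  have h2 : ¬ 2 * g + V.rank v % g < 2 * g := by omega
  simp only [squaringAlgorithm, hnodes, ← hg, if_neg h1, if_neg h2, Nat.add_sub_cancel_left]
  have hentry : minPlusEntry V (M (s + 1) x).table (V.rank u % g) (g + V.rank v % g) =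
      ⨅ w, D u w + D w v :=
    iInf_congr fun w => by rw [(htable w).1, (htable w).2, hsymm w u]
  rw [hentry, Nat.mod_eq_of_lt hle]

namespace WeightedNetwork

variable {p q : Polynomial ℕ} {n : ℕ} (N : WeightedNetwork p q n)

theorem insert_id_neighbors (hN : N.graph = ⊤) (v : N.nodes) :
    insert (v : ℕ) (N.localInput v).neighbors = N.nodes := by
  ext j
  simp only [localInput, hN, Finset.mem_insert, Finset.mem_image, Finset.mem_filter,
    Finset.mem_univ, true_and, SimpleGraph.top_adj]
  constructor
  · rintro (rfl | ⟨u, -, rfl⟩)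
    · exact v.2
    · exact u.2
  · intro hj
    by_cases h : j = v
    · exact Or.inl h
    · exact Or.inr ⟨⟨j, hj⟩, fun h' => h (by rw [h']), rfl⟩

end WeightedNetwork

/-! ### Assembling the algorithm, its running time and the theorem. -/

/-- The number of bits for a distance on an `n`-node network with weights up to `q(n)`. -/
def distBits (q : Polynomial ℕ) (n : ℕ) : ℕ := Nat.clog 2 (q.eval n + 1) + 1

theorem eval_lt_two_pow_distBits (q : Polynomial ℕ) (n : ℕ) : q.eval n < 2 ^ distBits q n :=
  (Nat.le_pow_clog (by norm_num) _).trans (Nat.pow_le_pow_right (by norm_num) (Nat.le_succ _))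

/-- The running time of the exact all-pairs shortest paths algorithm. -/
def apspTime (q : Polynomial ℕ) (n : ℕ) : ℕ :=
  2 * distBits q n * (3 * (Nat.sqrt n + 2) * distBits q n)

/-- The exact all-pairs shortest paths algorithm, where a node computes its output by `out` from its
private input and its distances to the nodes. -/
noncomputable def apspAlgorithm (q : Polynomial ℕ) {I O : Type} (out : I → (ℕ → ℕ) → O) (n : ℕ) :
    DistAlgorithm n I O :=
  (squaringAlgorithm I O out).stream n (3 * (Nat.sqrt n + 2)) (distBits q n)

theorem apspAlgorithm_outputAfter {p q : Polynomial ℕ} {n : ℕ} {I O : Type}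
    (out : I → (ℕ → ℕ) → O) (N : WeightedNetwork p q n) (hN : N.graph = ⊤) (x : N.nodes → I)
    (u : N.nodes) :
    ∃ d : ℕ → ℕ, (apspAlgorithm q out n).outputAfter N x (apspTime q n) u = out (x u) d ∧
      ∀ v : N.nodes, d v = N.dist u v := by
  obtain ⟨M, hinit, hstep, hout⟩ :=
    (squaringAlgorithm I O out).exists_memory (3 * (Nat.sqrt n + 2)) (distBits q n) N x hN
      (by simp [distBits])
  have hconst : ∀ s v, (M s v).id = v ∧ (M s v).nodes = N.nodes ∧ (M s v).input = x v := by
    intro s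
    induction s with
    | zero =>
      intro v
      rw [hinit]
      exact ⟨rfl, N.insert_id_neighbors hN v, rfl⟩
    | succ s ih =>
      intro v
      obtain ⟨f, hf, -⟩ := hstep s v
      rw [hf]
      exact ih v
  have hrow : ∀ k u (v : N.nodes), (M (2 * k) u).row v = N.powDist k u v := by
    intro k
    induction k with
    | zero => intro u v; rw [Nat.mul_zero, hinit]; rfl
    | succ k ih =>
      intro u v
      refine squaringAlgorithm_two_rounds out (fun s v => (hconst s v).1)
        (fun s v => (hconst s v).2.1) (fun s v => ?_) ih (N.powDist_comm hN k)
        (N.powDist_self k)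
        (fun u v => (N.powDist_le hN k u v).trans_lt (eval_lt_two_pow_distBits q n)) u v
      rw [groupSize, N.card_nodes]
      exact hstep s v
  -- `distBits` serves twice: as entry length and as number of squarings, since `q(n) < 2 ^
  -- distBits`.
  refine ⟨(M (2 * distBits q n) u).row, ?_, fun v => ?_⟩
  · rw [← (hconst (2 * distBits q n) u).2.2]
    exact hout _ u
  · rw [hrow]
    exact N.powDist_eq_dist hN (eval_lt_two_pow_distBits q n).le u v

theorem natClog_two_le_four_mul_log {n : ℕ} (hn : 2 ≤ n) :
    (Nat.clog 2 n : ℝ) ≤ 4 * Real.log n := by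
  have hn' : (2 : ℝ) ≤ n := by exact_mod_cast hn
  have h1 : (Nat.clog 2 n : ℝ) ≤ Nat.log 2 n + 1 := by
    have : Nat.clog 2 n ≤ Nat.log 2 n + 1 :=
      Nat.clog_le_of_le_pow (Nat.lt_pow_succ_log_self (by norm_num) n).le
    exact_mod_cast this
  have h2 : (Nat.log 2 n : ℝ) * Real.log 2 ≤ Real.log n := by
    rw [← Real.log_pow]
    apply Real.log_le_log (by positivity)
    exact_mod_cast Nat.pow_log_le_self 2 (by omega)
  have h3 : Real.log 2 ≤ Real.log n := Real.log_le_log (by norm_num) hn'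
  have h4 := Real.log_two_gt_d9
  have h5 : (0 : ℝ) ≤ Nat.log 2 n := Nat.cast_nonneg _
  nlinarith

theorem isSoftO_apspTime (q : Polynomial ℕ) : IsSoftO (apspTime q) fun n => Real.sqrt n := by
  obtain ⟨C, hC⟩ := q.exists_log_eval_le
  refine ⟨2, IsBigO.of_bound (18 * (4 * (C + 1)) ^ 2) ?_⟩
  filter_upwards [eventually_ge_atTop 2] with n hn
  have hL : (distBits q n : ℝ) ≤ 4 * (C + 1) * Real.log n := by
    have h1 : distBits q n ≤ (C + 1) * Nat.clog 2 n := by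
      have := hC n hn
      have := Nat.clog_pos (b := 2) (by norm_num) hn
      rw [distBits, add_mul]
      omega
    have h2 : (distBits q n : ℝ) ≤ (C + 1) * Nat.clog 2 n := by exact_mod_cast h1
    have h3 := mul_le_mul_of_nonneg_left (natClog_two_le_four_mul_log hn)
      (by positivity : (0 : ℝ) ≤ C + 1)
    linarith
  have hR : 3 * ((Nat.sqrt n : ℝ) + 2) ≤ 9 * Real.sqrt n := by
    have h1 : (1 : ℝ) ≤ Real.sqrt n := Real.one_le_sqrt.2 (by exact_mod_cast (by omega : 1 ≤ n))
    have h2 := Real.nat_sqrt_le_real_sqrt (a := n)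
    linarith
  have hlog : 0 ≤ Real.log n := Real.log_natCast_nonneg n
  rw [Real.norm_of_nonneg (by positivity), Real.norm_of_nonneg (by positivity)]
  calc (apspTime q n : ℝ)
      = 2 * (3 * ((Nat.sqrt n : ℝ) + 2)) * (distBits q n : ℝ) ^ 2 := by
        simp only [apspTime]; push_cast; ring
    _ ≤ 2 * (9 * Real.sqrt n) * (4 * (C + 1) * Real.log n) ^ 2 := by gcongr
    _ = 18 * (4 * (C + 1)) ^ 2 * (Real.sqrt n * Real.log n ^ 2) := by ring

theorem WeightedNetwork.dist_comm {p q : Polynomial ℕ} {n : ℕ} (N : WeightedNetwork p q n)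
    (hN : N.graph = ⊤) (u v : N.nodes) : N.dist u v = N.dist v u := by
  have h := (eval_lt_two_pow_distBits q n).le
  rw [← N.powDist_eq_dist hN h u v, ← N.powDist_eq_dist hN h v u, N.powDist_comm hN]

theorem uniformProb_of_forall {Ω : Type} [Fintype Ω] [Nonempty Ω] {E : Set Ω}
    (h : ∀ ω, ω ∈ E) : uniformProb E = 1 := by
  rw [Set.eq_univ_of_forall h, uniformProb, Set.ncard_univ, Nat.card_eq_fintype_card, div_self]
  exact_mod_cast Fintype.card_ne_zero

/-- Both parts follow from an algorithm that deterministically computes all distances exactly in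
`O(√n log² n)` rounds, by iterated min-plus squaring of the weight matrix. So the estimates in the
second part are even exact, and no random bits are used. -/
theorem mainTheorem4 (p q : Polynomial ℕ) :
    (∃ (T : ℕ → ℕ) (A : ∀ n, DistAlgorithm n ℕ ℕ),
      IsSoftO T (fun n => Real.sqrt n) ∧
      ∀ (n : ℕ) (N : WeightedNetwork p q n), N.graph = ⊤ → (A n).SolvesSSSP N (T n)) ∧
    (∀ c : ℕ, ∃ (T : ℕ → ℕ) (ε : ℕ → ℝ) (r : ℕ → ℕ)
        (A : ∀ n, DistAlgorithm n (Fin (r n) → Bool) (ℕ → ℝ)),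
      IsSoftO T (fun n => Real.sqrt n) ∧
      Tendsto ε atTop (𝓝 0) ∧
      ∀ (n : ℕ) (N : WeightedNetwork p q n), N.graph = ⊤ →
        1 - 1 / (n : ℝ) ^ c ≤
          uniformProb {ω : N.nodes → Fin (r n) → Bool |
            (A n).ApproximatesAPSP N ω (T n) (2 + ε n)}) := by
  refine ⟨⟨apspTime q, apspAlgorithm q fun s d => d s, isSoftO_apspTime q, ?_⟩, fun c =>
    ⟨apspTime q, fun _ => 0, fun _ => 0, fun n => apspAlgorithm q (fun _ d v => (d v : ℝ)) n,
      isSoftO_apspTime q, tendsto_const_nhds, fun n N hN => ?_⟩⟩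
  · intro n N hN s v
    obtain ⟨d, hout, hd⟩ := apspAlgorithm_outputAfter (fun s d => d s) N hN (fun _ => (s : ℕ)) v
    rw [hout, hd, N.dist_comm hN]
  · have hall : ∀ ω : N.nodes → Fin 0 → Bool,
        (apspAlgorithm q (fun _ d v => (d v : ℝ)) n).ApproximatesAPSP N ω (apspTime q n)
          (2 + 0) := by
      intro ω
      have hval : ∀ u v : N.nodes, (apspAlgorithm q (fun _ d v => (d v : ℝ)) n).outputAfter N ω
          (apspTime q n) u v = N.dist u v := by
        intro u v
        obtain ⟨d, hout, hd⟩ :=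
          apspAlgorithm_outputAfter (fun _ d v => (d v : ℝ)) N hN ω u
        rw [hout]
        exact congrArg Nat.cast (hd v)
      intro u v
      rw [hval, hval, N.dist_comm hN u v]
      refine ⟨rfl, le_rfl, ?_⟩
      have : (0 : ℝ) ≤ N.dist v u := Nat.cast_nonneg _
      linarith
    refine le_of_le_of_eq ?_ (uniformProb_of_forall fun ω => hall ω).symm
    have : (0 : ℝ) ≤ 1 / (n : ℝ) ^ c := by positivity
    linarith
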